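/- Let $G$ be a finite group and $\mathbb{Z}G$ its integral group ring. The bicyclic units of $\mathbb{Z}G$ are the units of one of the two forms $$\beta_{x,h}=1+(1-h)\,x\,(1+h+\cdots+h^{d-1}),\qquad \gamma_{x,h}=1+(1+h+\cdots+h^{d-1})\,x\,(1-h),$$ where $x,h\in G$ and $h$ has order $d$. Two bicyclic units are of the same type if both are of the form $\beta_{x,h}$ or both are of the form $\gamma_{x,h}$. A pair $(u,v)$ of units is called a free pair if $u$ and $v$ freely generate a (non-abelian) free group of rank $2$. Let $M(G)$ be the least positive integer $m$ such that $(\alpha,\beta^m)$ is a free pair for all bicyclic units $\alpha=1+a$ and $\beta=1+b$ of $\mathbb{Z}G$ with $ab$ not nilpotent, and let $m(G)$ be the least positive integer $m$ such that $(\alpha,\beta^m)$ is a free pair for all bicyclic units $\alpha=1+a$ and $\beta=1+b$ of $\mathbb{Z}G$ of the same type with $ab$ not nilpotent (with value $\infty$ if there is no such $m$). Then, for the symmetric groups $S_3$ and $S_4$, $$M(S_3)=2\qquad\text{and}\qquad m(S_4)=2 .$$ -/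

import Mathlib

noncomputable section

namespace BicyclicUnits

variable {G : Type*} [Group G]

/-- The image of a group element `g` in the integral group ring `ℤG`. -/
def el (g : G) : MonoidAlgebra ℤ G := MonoidAlgebra.of ℤ G g

/-- `1 + h + h ^ 2 + ⋯ + h ^ (d - 1)` in `ℤG`, where `d` is the order of `h`. -/
def hat (h : G) : MonoidAlgebra ℤ G := ∑ i ∈ Finset.range (orderOf h), el h ^ i

theorem el_pow_orderOf (h : G) : el h ^ orderOf h = 1 := by
  rw [el, ← map_pow, pow_orderOf_eq_one, map_one]

theorem hat_mul_one_sub (h : G) : hat h * (1 - el h) = 0 := by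
  rw [hat, ← neg_sub, mul_neg, geom_sum_mul, el_pow_orderOf, sub_self, neg_zero]

/-- `(1 - h) x (1 + h + ⋯ + h ^ (d - 1))`. -/
def betaNil (x h : G) : MonoidAlgebra ℤ G := (1 - el h) * el x * hat h

/-- `(1 + h + ⋯ + h ^ (d - 1)) x (1 - h)`. -/
def gammaNil (x h : G) : MonoidAlgebra ℤ G := hat h * el x * (1 - el h)

theorem one_sub_mul_hat (h : G) : (1 - el h) * hat h = 0 := by
  rw [hat, ← neg_sub, neg_mul, mul_geom_sum, el_pow_orderOf, sub_self, neg_zero]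

theorem betaNil_mul_self (x h : G) : betaNil x h * betaNil x h = 0 := by
  have e : betaNil x h * betaNil x h
      = (1 - el h) * el x * (hat h * (1 - el h)) * el x * hat h := by
    simp only [betaNil, mul_assoc]
  rw [e, hat_mul_one_sub]; simp

theorem gammaNil_mul_self (x h : G) : gammaNil x h * gammaNil x h = 0 := by
  have e : gammaNil x h * gammaNil x h
      = hat h * el x * ((1 - el h) * hat h) * el x * (1 - el h) := by
    simp only [gammaNil, mul_assoc]
  rw [e, one_sub_mul_hat]; simp

/-- If `a * a = 0`, then `1 + a` is a unit, with inverse `1 - a`. -/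
def oneAddUnit {R : Type*} [Ring R] (a : R) (ha : a * a = 0) : Rˣ where
  val := 1 + a
  inv := 1 - a
  val_inv := by
    have e : (1 + a) * (1 - a) = 1 - a * a := by noncomm_ring
    rw [e, ha, sub_zero]
  inv_val := by
    have e : (1 - a) * (1 + a) = 1 - a * a := by noncomm_ring
    rw [e, ha, sub_zero]

/-- The bicyclic unit `β_{x,h} = 1 + (1 - h) x (1 + h + ⋯ + h ^ (d - 1))` of `ℤG`. -/
def betaUnit (x h : G) : (MonoidAlgebra ℤ G)ˣ := oneAddUnit (betaNil x h) (betaNil_mul_self x h)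

/-- The bicyclic unit `γ_{x,h} = 1 + (1 + h + ⋯ + h ^ (d - 1)) x (1 - h)` of `ℤG`. -/
def gammaUnit (x h : G) : (MonoidAlgebra ℤ G)ˣ :=
  oneAddUnit (gammaNil x h) (gammaNil_mul_self x h)

/-- Bicyclic units of type `β`: the units `β_{x,h}` with `x, h ∈ G` and `h` of finite order. -/
def IsBetaBicyclic (u : (MonoidAlgebra ℤ G)ˣ) : Prop :=
  ∃ x h : G, IsOfFinOrder h ∧ u = betaUnit x h

/-- Bicyclic units of type `γ`: the units `γ_{x,h}` with `x, h ∈ G` and `h` of finite order. -/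
def IsGammaBicyclic (u : (MonoidAlgebra ℤ G)ˣ) : Prop :=
  ∃ x h : G, IsOfFinOrder h ∧ u = gammaUnit x h

/-- Bicyclic units of `ℤG`, of either type. -/
def IsBicyclic (u : (MonoidAlgebra ℤ G)ˣ) : Prop := IsBetaBicyclic u ∨ IsGammaBicyclic u

/-- Two bicyclic units of the same type: both of type `β`, or both of type `γ`. -/
def AreBicyclicOfSameType (u v : (MonoidAlgebra ℤ G)ˣ) : Prop :=
  (IsBetaBicyclic u ∧ IsBetaBicyclic v) ∨ (IsGammaBicyclic u ∧ IsGammaBicyclic v)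

/-- `(u, v)` is a free pair: `u` and `v` freely generate a (non-abelian) free group of rank two. -/
def IsFreePair {U : Type*} [Group U] (u v : U) : Prop :=
  Function.Injective (FreeGroup.lift ![u, v])

variable (G)

/-- `M(G)`: the least positive integer `m` such that `(α, β ^ m)` is a free pair for all bicyclic
units `α = 1 + a` and `β = 1 + b` of `ℤG` with `a * b` not nilpotent (`⊤` if there is no such
`m`). -/
def bigM : ℕ∞ :=
  sInf ((fun m : ℕ => (m : ℕ∞)) '' {m : ℕ | 0 < m ∧ ∀ α β : (MonoidAlgebra ℤ G)ˣ,
    IsBicyclic α → IsBicyclic β →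
    ¬ IsNilpotent (((α : MonoidAlgebra ℤ G) - 1) * ((β : MonoidAlgebra ℤ G) - 1)) →
    IsFreePair α (β ^ m)})

/-- `m(G)`: the same as `M(G)`, with `α` and `β` restricted to bicyclic units of the same type. -/
def smallM : ℕ∞ :=
  sInf ((fun m : ℕ => (m : ℕ∞)) '' {m : ℕ | 0 < m ∧ ∀ α β : (MonoidAlgebra ℤ G)ˣ,
    AreBicyclicOfSameType α β →
    ¬ IsNilpotent (((α : MonoidAlgebra ℤ G) - 1) * ((β : MonoidAlgebra ℤ G) - 1)) →
    IsFreePair α (β ^ m)})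

end BicyclicUnits

end

noncomputable section

open scoped Pointwise

namespace BicyclicUnits

/-! For a bicyclic unit 1 + a one has a² = 0, so a vanishes under every character with values in ℤ.
In a permutation representation of degree at most 4, possibly twisted by a character, a therefore
kills the all-ones vector and maps into the sum-zero hyperplane. With a² = 0 this forces rank at
most one, whence aba = t a with t = tr(ab) (`mul_mul_eq_trace_smul`).

Since (1 + b)² = 1 + 2b, a trace with |t| ≥ 2 yields ping-pong for (α, β²)
(`isFreePair_of_mul_mul_eq_smul`). If every trace has |t| ≤ 1, congruences between characters force
all of them to be 0. Then aba vanishes in a jointly faithful family of representations, so ab is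
nilpotent. Only a² = b² = 0 is used here.

Exponent 1 fails by explicit relations: (αβ)³ = 1 for a mixed pair in S₃ with t = -3, and commuting
(αβ)², (α⁻¹β)² for a pair of type β in S₄ with traces ±2. -/

/-! ### Free pairs and ping-pong -/

theorem IsFreePair.of_map {U V : Type*} [Group U] [Group V] (f : U →* V) {u v : U}
    (h : IsFreePair (f u) (f v)) : IsFreePair u v := by
  have e : FreeGroup.lift ![f u, f v] = f.comp (FreeGroup.lift ![u, v]) := by
    ext i; fin_cases i <;> simp
  rw [IsFreePair, e, MonoidHom.coe_comp] at h
  exact h.of_comp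

theorem val_zpow_of_sq_zero {R : Type*} [Ring R] (u : Rˣ) {a : R} (hu : (u : R) = 1 + a)
    (ha : a * a = 0) (n : ℤ) : ((u ^ n : Rˣ) : R) = 1 + n • a := by
  have hinv : ((u⁻¹ : Rˣ) : R) = 1 - a := by
    refine Units.inv_eq_of_mul_eq_one_right ?_
    rw [hu, mul_sub, mul_one, add_mul, one_mul, ha, add_zero, add_sub_cancel_right]
  induction n with
  | zero => simp
  | succ n ih =>
    rw [zpow_add_one, Units.val_mul, ih, hu, add_smul, one_smul, add_mul, mul_add, mul_add,
      smul_mul_assoc, smul_mul_assoc, ha]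
    simp only [mul_one, one_mul, smul_zero]
    abel
  | pred n ih =>
    rw [zpow_sub_one, Units.val_mul, ih, hinv, sub_smul, one_smul, add_mul, mul_sub, mul_sub,
      smul_mul_assoc, smul_mul_assoc, ha]
    simp only [mul_one, one_mul, smul_zero]
    abel

/-- A ping-pong criterion: two square-zero elements `a`, `b` of a torsion-free ring with
`a * b * a = t • a ≠ 0` and `4 ≤ |t|` give a free pair. -/
theorem isFreePair_of_mul_mul_eq_smul {R : Type*} [Ring R] [IsAddTorsionFree R] (u v : Rˣ) {a b : R}
    (hu : (u : R) = 1 + a) (hv : (v : R) = 1 + b) (ha : a * a = 0) (hb : b * b = 0) (ha0 : a ≠ 0)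
    (t : ℤ) (ht : 4 ≤ |t|) (h : a * b * a = t • a) : IsFreePair u v := by
  have ht0 : t ≠ 0 := by rintro rfl; simp at ht
  -- Left multiplication by a kills x a and turns y ba into y t a.
  have indep : ∀ x y : ℤ, x • a + y • (b * a) = 0 → x = 0 ∧ y = 0 := by
    intro x y hxy
    have h1 : (y * t) • a = 0 := by
      have := congrArg (a * ·) hxy
      simpa only [mul_add, mul_smul_comm, ha, ← mul_assoc, h, smul_smul, smul_zero, zero_add,
        mul_zero] using this
    have hy : y = 0 := by
      rcases smul_eq_zero.1 h1 with h2 | h2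
      · exact (mul_eq_zero.1 h2).resolve_right ht0
      · exact absurd h2 ha0
    subst hy
    simp only [zero_smul, add_zero] at hxy
    exact ⟨(smul_eq_zero.1 hxy).resolve_right ha0, rfl⟩
  have hinj : ∀ x y x' y' : ℤ, x • a + y • (b * a) = x' • a + y' • (b * a) → x = x' ∧ y = y' := by
    intro x y x' y' e
    have := indep (x - x') (y - y') (by
      rw [sub_smul, sub_smul, sub_add_sub_comm, e, sub_self])
    omega
  -- In the coordinates (x, y) of x a + y ba, u ^ n acts as (x + n t y, y) and v ^ n as (x, y + n
  -- x). The slope 2 suits both: 4|y| - |x| > 2|y| on the second cone, and |x| - |y| > |x|/2 on the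
  -- first.
  let X : Fin 2 → Set R := ![{r | ∃ x y : ℤ, 2 * |y| < |x| ∧ r = x • a + y • (b * a)},
    {r | ∃ x y : ℤ, |x| < 2 * |y| ∧ r = x • a + y • (b * a)}]
  have hdisj : Disjoint (X 0) (X 1) := by
    rw [Set.disjoint_left]
    rintro _ ⟨x, y, hxy, rfl⟩ ⟨x', y', hxy', e⟩
    obtain ⟨rfl, rfl⟩ := hinj _ _ _ _ e
    omega
  have e : FreeGroup.lift ![u, v] =
      (Monoid.CoprodI.lift fun i => FreeGroup.lift fun _ : Unit => ![u, v] i).comp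
        (@freeGroupEquivCoprodI (Fin 2)).toMonoidHom := by
    ext i; simp
  rw [IsFreePair, e, MonoidHom.coe_comp]
  refine Function.Injective.comp ?_ (MulEquiv.injective freeGroupEquivCoprodI)
  refine Monoid.CoprodI.lift_injective_of_ping_pong _ ?_ X ?_ ?_ ?_
  -- With only two factors, the ping-pong lemma needs one with at least three elements; each factor
  -- is infinite cyclic.
  · right
    refine ⟨0, ?_⟩
    rw [FreeGroup.freeGroupUnitEquivInt.cardinal_eq, Cardinal.mk_denumerable]
    exact Cardinal.natCast_le_aleph0
  · intro i
    fin_cases i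
    · exact ⟨_, 1, 0, by simp, rfl⟩
    · exact ⟨_, 0, 1, by simp, rfl⟩
  · intro i j hij
    fin_cases i <;> fin_cases j
    · exact absurd rfl hij
    · exact hdisj
    · exact hdisj.symm
    · exact absurd rfl hij
  · intro i j hij
    refine FreeGroup.freeGroupUnitEquivInt.forall_congr_left.mpr ?_
    intro n hn
    have hn0 : n ≠ 0 := by
      rintro rfl
      exact hn (by simp [FreeGroup.freeGroupUnitEquivInt])
    have hn1 : 1 ≤ |n| := Int.one_le_abs hn0
    change FreeGroup.lift (fun _ : Unit => ![u, v] i) (FreeGroup.of () ^ n) • X j ⊆ X i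
    simp only [map_zpow, FreeGroup.lift_apply_of]
    rintro _ ⟨r, hr, rfl⟩
    fin_cases i <;> fin_cases j
    · exact absurd rfl hij
    · obtain ⟨x, y, hxy, rfl⟩ := hr
      refine ⟨x + n * t * y, y, ?_, ?_⟩
      · have h1 : 4 * |y| ≤ |n * t * y| := by
          rw [abs_mul, abs_mul]
          gcongr
          nlinarith
        have h2 := abs_sub_abs_le_abs_add (n * t * y) x
        rw [add_comm x]
        omega
      · change ((u ^ n : Rˣ) : R) * _ = _
        rw [val_zpow_of_sq_zero u hu ha]
        simp only [add_mul, one_mul, mul_add, smul_mul_assoc, mul_smul_comm, ha, smul_zero,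
          ← mul_assoc, h, smul_smul, add_smul]
        module
    · obtain ⟨x, y, hxy, rfl⟩ := hr
      refine ⟨x, y + n * x, ?_, ?_⟩
      · have h1 : |x| ≤ |n * x| := by
          rw [abs_mul]
          nlinarith [abs_nonneg x]
        have h2 := abs_sub_abs_le_abs_add (n * x) y
        rw [add_comm y]
        omega
      · change ((v ^ n : Rˣ) : R) * _ = _
        rw [val_zpow_of_sq_zero v hv hb]
        simp only [add_mul, one_mul, mul_add, smul_mul_assoc, mul_smul_comm, hb, smul_zero,
          ← mul_assoc, zero_mul, add_smul]
        module
    · exact absurd rfl hij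

/-! ### Square-zero matrices of rank at most one -/

/-- The kernel contains the range and the all-ones vector. The latter is not in the range, whose
vectors have sum zero, so 2 · rank + 1 ≤ 4. -/
theorem exists_eq_vecMulVec {n : Type*} [Fintype n] [DecidableEq n] (hn : Fintype.card n ≤ 4)
    (A : Matrix n n ℚ) (hA : A * A = 0) (h1 : A.mulVec 1 = 0) (h2 : Matrix.vecMul 1 A = 0) :
    ∃ v w : n → ℚ, A = Matrix.vecMulVec v w := by
  rcases isEmpty_or_nonempty n with hn0 | hn0
  · exact ⟨0, 0, by ext i; exact hn0.elim i⟩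
  let f := A.mulVecLin
  have hsum : ∀ w ∈ LinearMap.range f, (1 : n → ℚ) ⬝ᵥ w = 0 := by
    rintro _ ⟨w, rfl⟩
    simp [f, Matrix.dotProduct_mulVec, h2]
  have hle : LinearMap.range f ⊔ Submodule.span ℚ {1} ≤ LinearMap.ker f := by
    refine sup_le ?_ ?_
    · rintro _ ⟨w, rfl⟩
      simp [f, hA]
    · rw [Submodule.span_singleton_le_iff_mem]
      simpa [f] using h1
  have hdisj : Disjoint (LinearMap.range f) (Submodule.span ℚ {(1 : n → ℚ)}) := by
    rw [Submodule.disjoint_def]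
    intro w hw hw'
    obtain ⟨c, rfl⟩ := Submodule.mem_span_singleton.1 hw'
    have := hsum _ hw
    simp at this
    simp [this]
  have hfr := Submodule.finrank_mono hle
  have hsup := Submodule.finrank_sup_add_finrank_inf_eq (LinearMap.range f)
    (Submodule.span ℚ {(1 : n → ℚ)})
  rw [hdisj.eq_bot, finrank_bot, finrank_span_singleton (one_ne_zero)] at hsup
  have hrn := LinearMap.finrank_range_add_finrank_ker f
  rw [Module.finrank_fintype_fun_eq_card] at hrn
  have hr : Module.finrank ℚ (LinearMap.range f) ≤ 1 := by omega
  obtain ⟨v, hv⟩ := finrank_le_one_iff.1 hr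
  have hw : ∀ j, ∃ c : ℚ, A.mulVec (Pi.single j 1) = c • (v : n → ℚ) := by
    intro j
    obtain ⟨c, hc⟩ := hv ⟨f (Pi.single j 1), LinearMap.mem_range_self _ _⟩
    exact ⟨c, by simpa [f] using (congrArg Subtype.val hc).symm⟩
  choose w hw using hw
  refine ⟨v, w, ?_⟩
  ext i j
  have := congrFun (hw j) i
  simpa [Matrix.vecMulVec_apply, mul_comm] using this

/-- Over ℚ, A = v wᵀ, so ABA = (wᵀBv) A and the scalar is tr(AB). -/
theorem mul_mul_eq_trace_smul {n : Type*} [Fintype n] [DecidableEq n] (hn : Fintype.card n ≤ 4)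
    (A B : Matrix n n ℤ) (hA : A * A = 0) (h1 : A.mulVec 1 = 0) (h2 : Matrix.vecMul 1 A = 0) :
    A * B * A = (A * B).trace • A := by
  let c := Int.castRingHom ℚ
  have hinj : Function.Injective (c.mapMatrix : Matrix n n ℤ →+* Matrix n n ℚ) := by
    intro M N h
    ext i j
    simpa [c] using congrFun (congrFun h i) j
  obtain ⟨v, w, hvw⟩ := exists_eq_vecMulVec hn (c.mapMatrix A)
    (by rw [← map_mul, hA, map_zero])
    (by
      ext i
      have := congrArg (Int.cast : ℤ → ℚ) (congrFun h1 i)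
      simpa [Matrix.mulVec, dotProduct, c] using this)
    (by
      ext i
      have := congrArg (Int.cast : ℤ → ℚ) (congrFun h2 i)
      simpa [Matrix.vecMul, dotProduct, c] using this)
  apply hinj
  have e : (((A * B).trace : ℤ) : ℚ) = (c.mapMatrix A * c.mapMatrix B).trace := by
    rw [← map_mul]
    simp [Matrix.trace, c]
  rw [map_mul, map_mul, map_zsmul, ← Int.cast_smul_eq_zsmul ℚ, e, hvw, Matrix.vecMulVec_mul,
    Matrix.trace_vecMulVec, Matrix.vecMulVec_mul_vecMulVec, Matrix.vecMulVec_smul, dotProduct_comm]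

/-! ### Twisted permutation representations -/

section PermRep

variable {G : Type*} [Group G] {n : ℕ}

theorem addMonoidHom_apply_eq_sum [Fintype G] {N : Type*} [AddCommGroup N]
    (F : MonoidAlgebra ℤ G →+ N) (z : MonoidAlgebra ℤ G) :
    F z = ∑ g, z.coeff g • F (el g) := by
  induction z using MonoidAlgebra.induction_linear with
  | zero => simp
  | add x y hx hy => simp [hx, hy, add_smul, Finset.sum_add_distrib]
  | single g r =>
    classical
    have e : MonoidAlgebra.single g r = r • el g := by simp [el]
    rw [e, map_zsmul, Finset.sum_eq_single g]
    · simp [el]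
    · intro h _ hh
      simp [el, Finsupp.single_eq_of_ne hh]
    · simp

/-- The ring homomorphism `ℤG → ℤ` extending a character. -/
def augmentation (χ : G →* ℤ) : MonoidAlgebra ℤ G →ₐ[ℤ] ℤ := MonoidAlgebra.lift ℤ ℤ G χ

@[simp]
theorem augmentation_el (χ : G →* ℤ) (g : G) : augmentation χ (el g) = χ g := by
  simp [augmentation, el]

/-- The matrix of a permutation representation twisted by a character. -/
def permMat (χ : G →* ℤ) (f : G →* Function.End (Fin n)) : G →* Matrix (Fin n) (Fin n) ℤ where
  toFun g := Matrix.of fun i j => if f g j = i then χ g else 0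
  map_one' := by
    ext i j
    simp [Matrix.one_apply, eq_comm, Function.End.one_def]
  map_mul' g h := by
    ext i j
    simp [Matrix.mul_apply, Function.End.mul_def, mul_comm (χ g)]
    rfl

theorem permMat_apply (χ : G →* ℤ) (f : G →* Function.End (Fin n)) (g : G) (i j : Fin n) :
    permMat χ f g i j = if f g j = i then χ g else 0 := rfl

/-- The integral representation of `ℤG` given by a permutation representation twisted by a
character. -/
def permRep (χ : G →* ℤ) (f : G →* Function.End (Fin n)) :
    MonoidAlgebra ℤ G →ₐ[ℤ] Matrix (Fin n) (Fin n) ℤ :=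
  MonoidAlgebra.lift ℤ _ G (permMat χ f)

@[simp]
theorem permRep_el (χ : G →* ℤ) (f : G →* Function.End (Fin n)) (g : G) :
    permRep χ f (el g) = permMat χ f g := by
  simp [permRep, el]

variable [Fintype G]

theorem augmentation_eq_sum (χ : G →* ℤ) (z : MonoidAlgebra ℤ G) :
    augmentation χ z = ∑ g, z.coeff g * χ g := by
  simpa using addMonoidHom_apply_eq_sum (augmentation χ : MonoidAlgebra ℤ G →+ ℤ) z

theorem permRep_eq_sum (χ : G →* ℤ) (f : G →* Function.End (Fin n)) (z : MonoidAlgebra ℤ G) :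
    permRep χ f z = ∑ g, z.coeff g • permMat χ f g := by
  simpa using addMonoidHom_apply_eq_sum
    (permRep χ f : MonoidAlgebra ℤ G →+ Matrix (Fin n) (Fin n) ℤ) z

theorem trace_permRep (χ : G →* ℤ) (f : G →* Function.End (Fin n)) (z : MonoidAlgebra ℤ G) :
    (permRep χ f z).trace = ∑ g, z.coeff g * (permMat χ f g).trace := by
  simp [permRep_eq_sum, Matrix.trace_sum, -zsmul_eq_mul]

omit [Group G] in
theorem dvd_sum_coeff_mul {m : ℤ} (z : MonoidAlgebra ℤ G) {F : G → ℤ} (h : ∀ g, m ∣ F g) :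
    m ∣ ∑ g, z.coeff g * F g :=
  Finset.dvd_sum fun g _ => (h g).mul_left _

theorem permRep_mulVec_one (χ : G →* ℤ) (f : G →* Function.End (Fin n)) (z : MonoidAlgebra ℤ G) :
    (permRep χ f z).mulVec 1 = augmentation χ z • 1 := by
  have key : ∀ g, (permMat χ f g).mulVec 1 = χ g • 1 := by
    intro g
    ext i
    have e : ∀ j, f g j = i ↔ j = f g⁻¹ i := by
      have h1 : ∀ a b : G, a * b = 1 → ∀ k, f a (f b k) = k := fun a b hab k => by
        have := congrFun (map_mul f a b) k
        rw [hab, map_one] at this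
        exact this.symm
      intro j
      constructor
      · rintro rfl
        rw [h1 _ _ (inv_mul_cancel g)]
      · rintro rfl
        rw [h1 _ _ (mul_inv_cancel g)]
    simp [Matrix.mulVec, dotProduct, permMat_apply, e]
  rw [permRep_eq_sum, augmentation_eq_sum, Matrix.sum_mulVec, Finset.sum_smul]
  simp only [Matrix.smul_mulVec, key, mul_smul]

theorem one_vecMul_permRep (χ : G →* ℤ) (f : G →* Function.End (Fin n)) (z : MonoidAlgebra ℤ G) :
    Matrix.vecMul 1 (permRep χ f z) = augmentation χ z • 1 := by
  have key : ∀ g, Matrix.vecMul 1 (permMat χ f g) = χ g • 1 := by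
    intro g
    ext i
    simp [Matrix.vecMul, dotProduct, permMat_apply]
  rw [permRep_eq_sum, augmentation_eq_sum, Matrix.vecMul_sum, Finset.sum_smul]
  simp only [Matrix.vecMul_smul, key, mul_smul]

omit [Fintype G] in
theorem augmentation_eq_zero_of_sq_zero (χ : G →* ℤ) {a : MonoidAlgebra ℤ G} (ha : a * a = 0) :
    augmentation χ a = 0 := by
  have := congrArg (augmentation χ) ha
  simpa using this

theorem permRep_mul_mul (χ : G →* ℤ) (f : G →* Function.End (Fin n)) (hn : n ≤ 4)
    {a : MonoidAlgebra ℤ G} (ha : a * a = 0) (b : MonoidAlgebra ℤ G) :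
    permRep χ f a * permRep χ f b * permRep χ f a =
      (permRep χ f (a * b)).trace • permRep χ f a := by
  rw [mul_mul_eq_trace_smul (by simpa using hn), map_mul]
  · rw [← map_mul, ha, map_zero]
  · rw [permRep_mulVec_one, augmentation_eq_zero_of_sq_zero χ ha, zero_smul]
  · rw [one_vecMul_permRep, augmentation_eq_zero_of_sq_zero χ ha, zero_smul]

theorem isFreePair_of_two_le_abs_trace (χ : G →* ℤ) (f : G →* Function.End (Fin n)) (hn : n ≤ 4)
    {α β : (MonoidAlgebra ℤ G)ˣ} {a b : MonoidAlgebra ℤ G} (hα : (α : MonoidAlgebra ℤ G) = 1 + a)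
    (hβ : (β : MonoidAlgebra ℤ G) = 1 + b) (ha : a * a = 0) (hb : b * b = 0)
    (ht : 2 ≤ |(permRep χ f (a * b)).trace|) : IsFreePair α (β ^ 2) := by
  have : IsAddTorsionFree (Matrix (Fin n) (Fin n) ℤ) :=
    inferInstanceAs (IsAddTorsionFree (Fin n → Fin n → ℤ))
  refine IsFreePair.of_map (Units.map ((permRep χ f : MonoidAlgebra ℤ G →+* Matrix (Fin n) (Fin n) ℤ) :
    MonoidAlgebra ℤ G →* Matrix (Fin n) (Fin n) ℤ)) ?_
  -- Here β² - 1 = b + b, which doubles the trace to reach the ping-pong bound 4.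
  refine isFreePair_of_mul_mul_eq_smul _ _ (a := permRep χ f a) (b := permRep χ f (b + b))
    ?_ ?_ ?_ ?_ ?_ (2 * (permRep χ f (a * b)).trace) ?_ ?_
  · simp [hα]
  · have h : ((β ^ 2 : (MonoidAlgebra ℤ G)ˣ) : MonoidAlgebra ℤ G) = 1 + (b + b) := by
      rw [Units.val_pow_eq_pow_val, hβ, sq, mul_add, add_mul, add_mul, hb]
      simp [add_assoc]
    rw [← map_one (permRep χ f), ← map_add, ← h]
    rfl
  · rw [← map_mul, ha, map_zero]
  · rw [← map_mul, add_mul, mul_add, hb]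
    simp
  · intro h
    rw [map_mul, h] at ht
    simp at ht
  · rw [abs_mul, abs_two]
    linarith
  · rw [map_add, mul_add, add_mul, permRep_mul_mul χ f hn ha, two_mul, add_smul]

end PermRep

/-! ### Characters of S₃ and S₄, and the upper bounds -/

theorem isNilpotent_mul_of_mul_mul_eq_zero {R : Type*} [Ring R] {a b : R} (h : a * b * a = 0) :
    IsNilpotent (a * b) := ⟨2, by rw [sq, ← mul_assoc, h, zero_mul]⟩

/-- The sign character with values in `ℤ`. -/
def sgn (n : ℕ) : Equiv.Perm (Fin n) →* ℤ := (Units.coeHom ℤ).comp Equiv.Perm.sign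

/-- The natural action of the symmetric group. -/
def natAct (n : ℕ) : Equiv.Perm (Fin n) →* Function.End (Fin n) where
  toFun g := (g : Fin n → Fin n)
  map_one' := rfl
  map_mul' _ _ := rfl

/-- The elements of the Klein four-group, indexed by the image of `0`. -/
def klein : Fin 4 → Equiv.Perm (Fin 4) :=
  ![1, Equiv.swap 0 1 * Equiv.swap 2 3, Equiv.swap 0 2 * Equiv.swap 1 3,
    Equiv.swap 0 3 * Equiv.swap 1 2]

/-- The conjugation action of the symmetric group of degree four on its Klein four-group. -/
def kleinAct : Equiv.Perm (Fin 4) →* Function.End (Fin 4) where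
  toFun g j := (g * klein j * g⁻¹) 0
  map_one' := by
    funext j
    revert j
    decide
  map_mul' := by
    have h : ∀ g h : Equiv.Perm (Fin 4), ∀ j,
        (g * h * klein j * (g * h)⁻¹) 0 = (g * klein ((h * klein j * h⁻¹) 0) * g⁻¹) 0 := by
      decide +kernel
    exact fun g k => funext (h g k)

/-- The regular character is -1 + sgn + 2π, with π the natural permutation character. Evaluated on
g⁻¹z it equals 6 times the coefficient of z at g. -/
theorem permRep_three_injective (z : MonoidAlgebra ℤ (Equiv.Perm (Fin 3)))
    (h0 : augmentation 1 z = 0) (h1 : augmentation (sgn 3) z = 0)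
    (h2 : permRep 1 (natAct 3) z = 0) : z = 0 := by
  have key : ∀ g : Equiv.Perm (Fin 3),
      -(1 : Equiv.Perm (Fin 3) →* ℤ) g + sgn 3 g + 2 * (permMat 1 (natAct 3) g).trace =
        if g = 1 then 6 else 0 := by
    decide +kernel
  ext g
  let w := el g⁻¹ * z
  have hw0 : augmentation 1 w = 0 := by rw [map_mul, h0, mul_zero]
  have hw1 : augmentation (sgn 3) w = 0 := by rw [map_mul, h1, mul_zero]
  have hw2 : (permRep 1 (natAct 3) w).trace = 0 := by
    rw [map_mul, h2, mul_zero, Matrix.trace_zero]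
  have hw : w.coeff 1 = z.coeff g := by
    simp [w, el, MonoidAlgebra.coeff_single_mul_apply]
  rw [augmentation_eq_sum] at hw0 hw1
  rw [trace_permRep] at hw2
  have hs : ∑ k, w.coeff k * (-(1 : Equiv.Perm (Fin 3) →* ℤ) k + sgn 3 k +
      2 * (permMat 1 (natAct 3) k).trace) = 0 := by
    simp only [mul_add, Finset.sum_add_distrib, mul_neg, Finset.sum_neg_distrib, hw0, hw1,
      mul_left_comm _ (2 : ℤ), ← Finset.mul_sum, hw2]
    norm_num
  simp only [key, mul_ite, mul_zero, Finset.sum_ite_eq', Finset.mem_univ, if_true] at hs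
  rw [← hw]
  simpa using hs

/-- The regular character is written in the five given ones. The Klein action contributes two
trivial summands and the 2-dimensional irreducible; the natural action and its sign twist contribute
the two 3-dimensional ones. -/
theorem permRep_four_injective (z : MonoidAlgebra ℤ (Equiv.Perm (Fin 4)))
    (h0 : augmentation 1 z = 0) (h1 : augmentation (sgn 4) z = 0)
    (h2 : permRep 1 kleinAct z = 0) (h3 : permRep 1 (natAct 4) z = 0)
    (h4 : permRep (sgn 4) (natAct 4) z = 0) : z = 0 := by
  have key : ∀ g : Equiv.Perm (Fin 4),
      -6 * (1 : Equiv.Perm (Fin 4) →* ℤ) g + -2 * sgn 4 g + 2 * (permMat 1 kleinAct g).trace +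
        3 * (permMat 1 (natAct 4) g).trace + 3 * (permMat (sgn 4) (natAct 4) g).trace =
        if g = 1 then 24 else 0 := by
    decide +kernel
  ext g
  let w := el g⁻¹ * z
  have hw0 : augmentation 1 w = 0 := by rw [map_mul, h0, mul_zero]
  have hw1 : augmentation (sgn 4) w = 0 := by rw [map_mul, h1, mul_zero]
  have hw2 : (permRep 1 kleinAct w).trace = 0 := by
    rw [map_mul, h2, mul_zero, Matrix.trace_zero]
  have hw3 : (permRep 1 (natAct 4) w).trace = 0 := by
    rw [map_mul, h3, mul_zero, Matrix.trace_zero]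
  have hw4 : (permRep (sgn 4) (natAct 4) w).trace = 0 := by
    rw [map_mul, h4, mul_zero, Matrix.trace_zero]
  have hw : w.coeff 1 = z.coeff g := by
    simp [w, el, MonoidAlgebra.coeff_single_mul_apply]
  rw [augmentation_eq_sum] at hw0 hw1
  rw [trace_permRep] at hw2 hw3 hw4
  have hs := Finset.sum_congr (rfl : (Finset.univ : Finset (Equiv.Perm (Fin 4))) = _)
    fun k _ => congrArg (w.coeff k * ·) (key k)
  simp only [mul_add, Finset.sum_add_distrib, mul_left_comm (w.coeff _), ← Finset.mul_sum, hw0,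
    hw1, hw2, hw3, hw4] at hs
  simp only [mul_ite, mul_zero, Finset.sum_ite_eq', Finset.mem_univ, if_true] at hs
  rw [← hw]
  simpa using hs.symm

theorem isFreePair_sq_three {α β : (MonoidAlgebra ℤ (Equiv.Perm (Fin 3)))ˣ}
    {a b : MonoidAlgebra ℤ (Equiv.Perm (Fin 3))} (hα : (α : MonoidAlgebra ℤ _) = 1 + a)
    (hβ : (β : MonoidAlgebra ℤ _) = 1 + b) (ha : a * a = 0) (hb : b * b = 0)
    (hab : ¬ IsNilpotent (a * b)) : IsFreePair α (β ^ 2) := by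
  have h0 : ∀ χ, augmentation χ (a * b) = 0 := fun χ => by
    rw [map_mul, augmentation_eq_zero_of_sq_zero χ ha, zero_mul]
  have hdvd : (6 : ℤ) ∣ 2 * (permRep 1 (natAct 3) (a * b)).trace := by
    -- This combination is the regular character of S₃, with values 6 and 0.
    have key : ∀ g : Equiv.Perm (Fin 3),
        6 ∣ 2 * (permMat 1 (natAct 3) g).trace + -(1 : Equiv.Perm (Fin 3) →* ℤ) g + sgn 3 g := by
      decide +kernel
    have := dvd_sum_coeff_mul (a * b) key
    simpa only [mul_add, Finset.sum_add_distrib, mul_left_comm ((a * b).coeff _), mul_neg,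
      Finset.sum_neg_distrib, ← Finset.mul_sum, ← augmentation_eq_sum, ← trace_permRep, h0, neg_zero,
      add_zero] using this
  refine isFreePair_of_two_le_abs_trace 1 (natAct 3) (by norm_num) hα hβ ha hb ?_
  by_contra hlt
  have ht : (permRep 1 (natAct 3) (a * b)).trace = 0 := by
    rw [not_le, abs_lt] at hlt
    omega
  refine hab (isNilpotent_mul_of_mul_mul_eq_zero (permRep_three_injective _ ?_ ?_ ?_))
  · rw [map_mul, h0, zero_mul]
  · rw [map_mul, h0, zero_mul]
  · rw [map_mul, map_mul, permRep_mul_mul _ _ (by norm_num) ha, ht, zero_smul]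

theorem isFreePair_sq_four {α β : (MonoidAlgebra ℤ (Equiv.Perm (Fin 4)))ˣ}
    {a b : MonoidAlgebra ℤ (Equiv.Perm (Fin 4))} (hα : (α : MonoidAlgebra ℤ _) = 1 + a)
    (hβ : (β : MonoidAlgebra ℤ _) = 1 + b) (ha : a * a = 0) (hb : b * b = 0)
    (hab : ¬ IsNilpotent (a * b)) : IsFreePair α (β ^ 2) := by
  have h0 : ∀ χ, augmentation χ (a * b) = 0 := fun χ => by
    rw [map_mul, augmentation_eq_zero_of_sq_zero χ ha, zero_mul]
  have hdvd2 : (6 : ℤ) ∣ 2 * (permRep 1 kleinAct (a * b)).trace := by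
    -- This is the regular character of the quotient S₃ of S₄ by the Klein group.
    have key : ∀ g : Equiv.Perm (Fin 4),
        6 ∣ 2 * (permMat 1 kleinAct g).trace + -3 * (1 : Equiv.Perm (Fin 4) →* ℤ) g + sgn 4 g := by
      decide +kernel
    have := dvd_sum_coeff_mul (a * b) key
    simpa only [mul_add, Finset.sum_add_distrib, mul_left_comm ((a * b).coeff _), ← Finset.mul_sum,
      ← augmentation_eq_sum, ← trace_permRep, h0, mul_zero, add_zero] using this
  have hdvd3 : (2 : ℤ) ∣ (permRep 1 (natAct 4) (a * b)).trace +
      (permRep 1 kleinAct (a * b)).trace := by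
    have key : ∀ g : Equiv.Perm (Fin 4),
        2 ∣ (permMat 1 (natAct 4) g).trace + (permMat 1 kleinAct g).trace := by
      decide +kernel
    have := dvd_sum_coeff_mul (a * b) key
    simpa only [mul_add, Finset.sum_add_distrib, ← trace_permRep] using this
  have hdvd4 : (2 : ℤ) ∣ (permRep (sgn 4) (natAct 4) (a * b)).trace +
      (permRep 1 kleinAct (a * b)).trace := by
    have key : ∀ g : Equiv.Perm (Fin 4),
        2 ∣ (permMat (sgn 4) (natAct 4) g).trace + (permMat 1 kleinAct g).trace := by
      decide +kernel
    have := dvd_sum_coeff_mul (a * b) key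
    simpa only [mul_add, Finset.sum_add_distrib, ← trace_permRep] using this
  by_contra hfree
  have hlt : ∀ χ f, |(permRep χ f (a * b)).trace| < 2 := fun χ (f : _ →* Function.End (Fin 4)) => by
    by_contra h
    exact hfree (isFreePair_of_two_le_abs_trace χ f le_rfl hα hβ ha hb (not_lt.1 h))
  have hlt2 := abs_lt.1 (hlt 1 kleinAct)
  have hlt3 := abs_lt.1 (hlt 1 (natAct 4))
  have hlt4 := abs_lt.1 (hlt (sgn 4) (natAct 4))
  have ht2 : (permRep 1 kleinAct (a * b)).trace = 0 := by omega
  have ht3 : (permRep 1 (natAct 4) (a * b)).trace = 0 := by omega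
  have ht4 : (permRep (sgn 4) (natAct 4) (a * b)).trace = 0 := by omega
  refine hab (isNilpotent_mul_of_mul_mul_eq_zero (permRep_four_injective _ ?_ ?_ ?_ ?_ ?_))
  · rw [map_mul, h0, zero_mul]
  · rw [map_mul, h0, zero_mul]
  · rw [map_mul, map_mul, permRep_mul_mul _ _ le_rfl ha, ht2, zero_smul]
  · rw [map_mul, map_mul, permRep_mul_mul _ _ le_rfl ha, ht3, zero_smul]
  · rw [map_mul, map_mul, permRep_mul_mul _ _ le_rfl ha, ht4, zero_smul]

/-! ### Relations forced by small traces -/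

section Relations

variable {R : Type*} [Ring R] {a b : R}

/-- On the span of a and ba the product has determinant 1 and trace 2 - 3 = -1, hence order 3. -/
theorem pow_three_eq_one (ha : a * a = 0) (hb : b * b = 0) (hab : a * b * a = (-3 : ℤ) • a)
    (hba : b * a * b = (-3 : ℤ) • b) : ((1 + a) * (1 + b)) ^ 3 = 1 := by
  have ha' : b * a * a = 0 := by rw [mul_assoc, ha, mul_zero]
  have hb' : a * b * b = 0 := by rw [mul_assoc, hb, mul_zero]
  simp only [pow_succ, pow_zero, mul_add, add_mul, one_mul, mul_one, ← mul_assoc, ha, hb, hab, hba,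
    ha', hb', smul_mul_assoc, smul_zero, add_zero]
  module

theorem sq_eq_of_mul_mul_eq (ha : a * a = 0) (hb : b * b = 0) (hab : a * b * a = (-2 : ℤ) • a)
    (hba : b * a * b = (-2 : ℤ) • b) : ((1 + a) * (1 + b)) ^ 2 = 1 + a * b + b * a := by
  have hb' : a * b * b = 0 := by rw [mul_assoc, hb, mul_zero]
  simp only [pow_succ, pow_zero, mul_add, add_mul, one_mul, mul_one, ← mul_assoc, ha, hb, hab, hba,
    hb', smul_mul_assoc, add_zero]
  module

/-- The square 1 + ab + ba of the first product commutes with both a and b, hence with every word in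
them. -/
theorem commute_sq_of_mul_mul_eq (ha : a * a = 0) (hb : b * b = 0)
    (hab : a * b * a = (-2 : ℤ) • a) (hba : b * a * b = (-2 : ℤ) • b) :
    Commute (((1 + a) * (1 + b)) ^ 2) (((1 - a) * (1 + b)) ^ 2) := by
  rw [sq_eq_of_mul_mul_eq ha hb hab hba]
  have hA : Commute (1 + a * b + b * a) a := by
    rw [commute_iff_eq]
    simp only [mul_add, add_mul, one_mul, mul_one, ← mul_assoc, hab, ha, zero_mul]
    simp only [mul_assoc, ha, mul_zero, add_zero]
  have hB : Commute (1 + a * b + b * a) b := by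
    rw [commute_iff_eq]
    simp only [mul_add, add_mul, one_mul, mul_one, ← mul_assoc, hba, hb, zero_mul]
    simp only [mul_assoc, hb, mul_zero, add_zero]
  exact (((Commute.one_right _).sub_right hA).mul_right
    ((Commute.one_right _).add_right hB)).pow_right 2

/-- Replacing a by -a changes the sign of the scalar and swaps the two words. -/
theorem commute_sq_of_mul_mul_eq_neg (ha : a * a = 0) (hb : b * b = 0)
    (hab : a * b * a = (2 : ℤ) • a) (hba : b * a * b = (2 : ℤ) • b) :
    Commute (((1 + a) * (1 + b)) ^ 2) (((1 - a) * (1 + b)) ^ 2) := by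
  have := commute_sq_of_mul_mul_eq (a := -a) (b := b) (by simpa using ha) hb (by simp [hab])
    (by simp [hba])
  rw [← sub_eq_add_neg, sub_neg_eq_add] at this
  exact this.symm

end Relations

/-! ### Pairs that are not free for exponent 1 -/

theorem hat_eq_of_orderOf_eq_two {G : Type*} [Group G] {h : G} (hh : orderOf h = 2) :
    hat h = 1 + el h := by
  simp [hat, hh, Finset.sum_range_succ]

theorem not_isNilpotent_of_trace_ne_zero {G : Type*} [Group G] {n : ℕ} (χ : G →* ℤ)
    (f : G →* Function.End (Fin n)) {z : MonoidAlgebra ℤ G} (h : (permRep χ f z).trace ≠ 0) :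
    ¬ IsNilpotent z := fun hz =>
  h (Matrix.isNilpotent_trace_of_isNilpotent (hz.map (permRep χ f))).eq_zero

theorem permRep_mul_mul' {G : Type*} [Group G] [Fintype G] {n : ℕ} (χ : G →* ℤ)
    (f : G →* Function.End (Fin n)) (hn : n ≤ 4) {b : MonoidAlgebra ℤ G} (hb : b * b = 0)
    (a : MonoidAlgebra ℤ G) : permRep χ f b * permRep χ f a * permRep χ f b =
      (permRep χ f (a * b)).trace • permRep χ f b := by
  rw [permRep_mul_mul χ f hn hb, map_mul, map_mul, Matrix.trace_mul_comm]

theorem orderOf_swap {n : ℕ} {i j : Fin n} (h : i ≠ j) : orderOf (Equiv.swap i j) = 2 :=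
  orderOf_eq_prime (by rw [sq, Equiv.swap_mul_self]) (by simpa using h)

theorem not_isFreePair_three : ∃ α β : (MonoidAlgebra ℤ (Equiv.Perm (Fin 3)))ˣ,
    IsBicyclic α ∧ IsBicyclic β ∧
      ¬ IsNilpotent (((α : MonoidAlgebra ℤ (Equiv.Perm (Fin 3))) - 1) *
        ((β : MonoidAlgebra ℤ (Equiv.Perm (Fin 3))) - 1)) ∧ ¬ IsFreePair α β := by
  set a := betaNil (Equiv.swap 0 2 : Equiv.Perm (Fin 3)) (Equiv.swap 0 1) with ha
  set b := gammaNil (Equiv.swap 0 1 : Equiv.Perm (Fin 3)) (Equiv.swap 0 2) with hb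
  have haa : a * a = 0 := betaNil_mul_self _ _
  have hbb : b * b = 0 := gammaNil_mul_self _ _
  have ht : (permRep 1 (natAct 3) (a * b)).trace = -3 := by
    rw [ha, hb, betaNil, gammaNil, hat_eq_of_orderOf_eq_two (orderOf_swap (by decide)),
      hat_eq_of_orderOf_eq_two (orderOf_swap (by decide))]
    simp only [map_mul, map_add, map_sub, map_one, permRep_el]
    decide +kernel
  refine ⟨betaUnit _ _, gammaUnit _ _, Or.inl ⟨Equiv.swap 0 2, Equiv.swap 0 1,
    isOfFinOrder_of_finite _, rfl⟩, Or.inr ⟨Equiv.swap 0 1, Equiv.swap 0 2,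
    isOfFinOrder_of_finite _, rfl⟩, ?_, ?_⟩
  · simp only [betaUnit, gammaUnit, oneAddUnit, add_sub_cancel_left]
    exact not_isNilpotent_of_trace_ne_zero 1 (natAct 3) (by rw [ht]; norm_num)
  · intro hfree
    have hrel : ((1 + a) * (1 + b)) ^ 3 = 1 := by
      rw [← sub_eq_zero]
      apply permRep_three_injective
      · simp [augmentation_eq_zero_of_sq_zero _ haa, augmentation_eq_zero_of_sq_zero _ hbb]
      · simp [augmentation_eq_zero_of_sq_zero _ haa, augmentation_eq_zero_of_sq_zero _ hbb]
      · simp only [map_sub, map_pow, map_mul, map_add, map_one]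
        rw [sub_eq_zero]
        refine pow_three_eq_one ?_ ?_ ?_ ?_
        · rw [← map_mul, haa, map_zero]
        · rw [← map_mul, hbb, map_zero]
        · rw [permRep_mul_mul _ _ (by norm_num) haa, ht]
        · rw [permRep_mul_mul' _ _ (by norm_num) hbb, ht]
    have hne : (FreeGroup.of (0 : Fin 2) * FreeGroup.of 1) ^ 3 ≠ 1 := by decide
    refine hne (hfree ?_)
    ext1
    simpa [betaUnit, gammaUnit, oneAddUnit] using hrel

theorem not_isFreePair_four : ∃ α β : (MonoidAlgebra ℤ (Equiv.Perm (Fin 4)))ˣ,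
    IsBetaBicyclic α ∧ IsBetaBicyclic β ∧
      ¬ IsNilpotent (((α : MonoidAlgebra ℤ (Equiv.Perm (Fin 4))) - 1) *
        ((β : MonoidAlgebra ℤ (Equiv.Perm (Fin 4))) - 1)) ∧ ¬ IsFreePair α β := by
  set a := betaNil (Equiv.swap 1 2 : Equiv.Perm (Fin 4)) (Equiv.swap 2 3) with ha
  set b := betaNil (Equiv.swap 0 1 * Equiv.swap 2 3 : Equiv.Perm (Fin 4)) (Equiv.swap 0 2) with hb
  have haa : a * a = 0 := betaNil_mul_self _ _
  have hbb : b * b = 0 := betaNil_mul_self _ _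
  have ha' : a = (1 - el (Equiv.swap 2 3)) * el (Equiv.swap 1 2) * (1 + el (Equiv.swap 2 3)) := by
    rw [ha, betaNil, hat_eq_of_orderOf_eq_two (orderOf_swap (by decide))]
  have hb' : b = (1 - el (Equiv.swap 0 2)) * el (Equiv.swap 0 1 * Equiv.swap 2 3) *
      (1 + el (Equiv.swap 0 2)) := by
    rw [hb, betaNil, hat_eq_of_orderOf_eq_two (orderOf_swap (by decide))]
  -- The element x of b lies in the Klein group, which acts trivially on itself by conjugation; so b
  -- maps to (1 - h)(1 + h) = 0.
  have ht2 : permRep 1 kleinAct a * permRep 1 kleinAct b =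
      permRep 1 kleinAct b * permRep 1 kleinAct a := by
    rw [ha', hb']
    simp only [map_mul, map_add, map_sub, map_one, permRep_el]
    decide +kernel
  have ht3 : (permRep 1 (natAct 4) (a * b)).trace = 2 := by
    rw [ha', hb']
    simp only [map_mul, map_add, map_sub, map_one, permRep_el]
    decide +kernel
  have ht4 : (permRep (sgn 4) (natAct 4) (a * b)).trace = -2 := by
    rw [ha', hb']
    simp only [map_mul, map_add, map_sub, map_one, permRep_el]
    decide +kernel
  refine ⟨betaUnit _ _, betaUnit _ _, ⟨Equiv.swap 1 2, Equiv.swap 2 3,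
    isOfFinOrder_of_finite _, rfl⟩, ⟨Equiv.swap 0 1 * Equiv.swap 2 3, Equiv.swap 0 2,
    isOfFinOrder_of_finite _, rfl⟩, ?_, ?_⟩
  · simp only [betaUnit, oneAddUnit, add_sub_cancel_left]
    exact not_isNilpotent_of_trace_ne_zero 1 (natAct 4) (by rw [ht3]; norm_num)
  · intro hfree
    -- The traces 2 and -2 make one or the other square central in the respective image, so the
    -- commutator relation holds in both.
    have hrel : Commute (((1 + a) * (1 + b)) ^ 2) (((1 - a) * (1 + b)) ^ 2) := by
      rw [commute_iff_eq, ← sub_eq_zero]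
      apply permRep_four_injective
      · simp [augmentation_eq_zero_of_sq_zero _ haa, augmentation_eq_zero_of_sq_zero _ hbb]
      · simp [augmentation_eq_zero_of_sq_zero _ haa, augmentation_eq_zero_of_sq_zero _ hbb]
      · simp only [map_sub, map_pow, map_mul, map_add, map_one]
        rw [sub_eq_zero, ← commute_iff_eq]
        have h : Commute (permRep 1 kleinAct a) (permRep 1 kleinAct b) := ht2
        have hA := (Commute.one_left (permRep 1 kleinAct a)).add_left (Commute.refl _)
        have hB := (Commute.one_left (permRep 1 kleinAct a)).add_left h.symm
        have hA' := (Commute.one_left (permRep 1 kleinAct b)).add_left h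
        have hB' := (Commute.one_left (permRep 1 kleinAct b)).add_left (Commute.refl _)
        exact (((Commute.one_right _).sub_right (hA.mul_left hB)).mul_right
          ((Commute.one_right _).add_right (hA'.mul_left hB'))).pow_pow 2 2
      · simp only [map_sub, map_pow, map_mul, map_add, map_one]
        rw [sub_eq_zero, ← commute_iff_eq]
        refine commute_sq_of_mul_mul_eq_neg ?_ ?_ ?_ ?_
        · rw [← map_mul, haa, map_zero]
        · rw [← map_mul, hbb, map_zero]
        · rw [permRep_mul_mul _ _ le_rfl haa, ht3]
        · rw [permRep_mul_mul' _ _ le_rfl hbb, ht3]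
      · simp only [map_sub, map_pow, map_mul, map_add, map_one]
        rw [sub_eq_zero, ← commute_iff_eq]
        refine commute_sq_of_mul_mul_eq ?_ ?_ ?_ ?_
        · rw [← map_mul, haa, map_zero]
        · rw [← map_mul, hbb, map_zero]
        · rw [permRep_mul_mul _ _ le_rfl haa, ht4]
        · rw [permRep_mul_mul' _ _ le_rfl hbb, ht4]
    have hne : (FreeGroup.of (0 : Fin 2) * FreeGroup.of 1) ^ 2 *
        ((FreeGroup.of (0 : Fin 2))⁻¹ * FreeGroup.of 1) ^ 2 ≠
        ((FreeGroup.of (0 : Fin 2))⁻¹ * FreeGroup.of 1) ^ 2 *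
        (FreeGroup.of (0 : Fin 2) * FreeGroup.of 1) ^ 2 := by decide
    refine hne (hfree ?_)
    ext1
    simpa [betaUnit, oneAddUnit] using hrel.eq

theorem IsBetaBicyclic.sub_one_mul_self {G : Type*} [Group G] {u : (MonoidAlgebra ℤ G)ˣ}
    (hu : IsBetaBicyclic u) :
    ((u : MonoidAlgebra ℤ G) - 1) * ((u : MonoidAlgebra ℤ G) - 1) = 0 := by
  obtain ⟨x, h, _, rfl⟩ := hu
  simpa [betaUnit, oneAddUnit] using betaNil_mul_self x h

theorem IsGammaBicyclic.sub_one_mul_self {G : Type*} [Group G] {u : (MonoidAlgebra ℤ G)ˣ}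
    (hu : IsGammaBicyclic u) :
    ((u : MonoidAlgebra ℤ G) - 1) * ((u : MonoidAlgebra ℤ G) - 1) = 0 := by
  obtain ⟨x, h, _, rfl⟩ := hu
  simpa [gammaUnit, oneAddUnit] using gammaNil_mul_self x h

theorem IsBicyclic.sub_one_mul_self {G : Type*} [Group G] {u : (MonoidAlgebra ℤ G)ˣ}
    (hu : IsBicyclic u) :
    ((u : MonoidAlgebra ℤ G) - 1) * ((u : MonoidAlgebra ℤ G) - 1) = 0 :=
  hu.elim IsBetaBicyclic.sub_one_mul_self IsGammaBicyclic.sub_one_mul_self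

/-! ### The two values -/

theorem sInf_image_natCast_eq_two {S : Set ℕ} (h0 : 0 ∉ S) (h1 : 1 ∉ S) (h2 : 2 ∈ S) :
    sInf ((fun m : ℕ => (m : ℕ∞)) '' S) = 2 := by
  refine le_antisymm (sInf_le ⟨2, h2, rfl⟩) (le_sInf ?_)
  rintro _ ⟨m, hm, rfl⟩
  have hm0 : m ≠ 0 := by rintro rfl; exact h0 hm
  have hm1 : m ≠ 1 := by rintro rfl; exact h1 hm
  have hm2 : 2 ≤ m := by omega
  change (2 : ℕ∞) ≤ (m : ℕ∞)
  exact_mod_cast hm2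

theorem bigM_three : bigM (Equiv.Perm (Fin 3)) = 2 := by
  refine sInf_image_natCast_eq_two (fun h => lt_irrefl 0 h.1) ?_ ⟨two_pos, ?_⟩
  · rintro ⟨-, h⟩
    obtain ⟨α, β, hα, hβ, hn, hfree⟩ := not_isFreePair_three
    exact hfree (by simpa using h α β hα hβ hn)
  · intro α β hα hβ hn
    exact isFreePair_sq_three (add_sub_cancel _ _).symm (add_sub_cancel _ _).symm
      hα.sub_one_mul_self hβ.sub_one_mul_self hn

theorem smallM_four : smallM (Equiv.Perm (Fin 4)) = 2 := by
  refine sInf_image_natCast_eq_two (fun h => lt_irrefl 0 h.1) ?_ ⟨two_pos, ?_⟩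
  · rintro ⟨-, h⟩
    obtain ⟨α, β, hα, hβ, hn, hfree⟩ := not_isFreePair_four
    exact hfree (by simpa using h α β (Or.inl ⟨hα, hβ⟩) hn)
  · rintro α β hαβ hn
    have hα : IsBicyclic α := hαβ.imp And.left And.left
    have hβ : IsBicyclic β := hαβ.imp And.right And.right
    exact isFreePair_sq_four (add_sub_cancel _ _).symm (add_sub_cancel _ _).symm
      hα.sub_one_mul_self hβ.sub_one_mul_self hn

end BicyclicUnits

end

theorem mainTheorem10 :
    BicyclicUnits.bigM (Equiv.Perm (Fin 3)) = 2 ∧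
      BicyclicUnits.smallM (Equiv.Perm (Fin 4)) = 2 :=
  ⟨BicyclicUnits.bigM_three, BicyclicUnits.smallM_four⟩
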